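/- All manifolds, maps and tensors are smooth. For an isometric immersion $f\colon M^m\to\mathbb{R}^k$ of a Riemannian manifold, let $\alpha_f(X,Y)$ be its second fundamental form, $A_\xi$ its shape operators, $\langle A_\xi X,Y\rangle=\langle\alpha_f(X,Y),\xi\rangle$, and $$III_f(X,Y)=\sum_{i=1}^m\langle\alpha_f(X,X_i),\alpha_f(Y,X_i)\rangle,\qquad (X_i)\text{ an orthonormal basis of }T_xM,$$ its third fundamental form. Its Gauss map $\phi_f\colon M\to Gr_m(\mathbb{R}^k)$ is $x\mapsto f_*T_xM$, where the Grassmannian carries its standard symmetric metric (in terms of orthogonal projections, $\langle S,T\rangle=\tfrac12\operatorname{tr}(ST)$). Isometric immersions $f,g\colon M^m\to\mathbb{R}^k$ are said to have isometric Gauss maps if the graphs $M\to M\times Gr_m(\mathbb{R}^k)$ of $\phi_f$ and $\phi_g$ induce the same metric on $M$. An isometric immersion $F\colon N^m\to\mathbb{R}^{m+1}$, $m\ge 3$, is a Sbrana--Cartan hypersurface if it has rank two, i.e. its relative nullity $\Delta=\{X:\alpha_F(X,\cdot)=0\}$ has dimension $m-2$ everywhere, and $N$ admits an isometric immersion into $\mathbb{R}^{m+1}$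 that is not congruent to $F$. It is surface-like if it is (locally) a cylinder over a surface in $\mathbb{R}^3$, or a cylinder over the cone of a surface in $\mathbb{S}^3\subset\mathbb{R}^4$. A Sbrana--Cartan hypersurface is elliptic if it is not surface-like and there is a tensor $J\in\Gamma(\operatorname{End}(\Delta^\perp))$ with $J^2=-I$ such that, for all $T\in\Gamma(\Delta)$, $\nabla_TJ=0$ and the splitting tensor $C_TX=-(\nabla_XT)_{\Delta^\perp}$ lies in $\operatorname{span}\{I,J\}$ at every point. **Proposition.** Let $n\ge 3$, let $F\colon\bar M^{n+1}\to\mathbb{R}^{n+2}$ be an elliptic Sbrana--Cartan hypersurface and let $G\colon\bar M^{n+1}\to\mathbb{R}^{n+2}$ be an isometric immersion of the same Riemannian manifold. Let $j\colon M^n\to\bar M^{n+1}$ be an isometric immersion such that at every point of $M^n$ $$\operatorname{tr}\big((A^F|_{j_*TM})_{j_*TM}\big)=\operatorname{tr}\big((A^G|_{j_*TM})_{j_*TM}\big)=0,$$ where $A^F,A^G$ are the shape operators of $F,G$ with respect to (either choice of) unit normal vectors and $(\cdot)_{j_*TM}$ is the orthogonal projection onto $j_*TM$. Then $f=F\circ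 j$ and $g=G\circ j$ have isometric Gauss maps, and $III_f=III_g$. -/

import Mathlib

open Bundle Manifold Filter
open scoped ContDiff Topology InnerProductSpace

noncomputable section

namespace GaussMaps

/-- Euclidean space `ℝᵐ`. -/
abbrev E (m : ℕ) : Type := EuclideanSpace ℝ (Fin m)

section Immersions

variable (m k : ℕ)
  {M : Type*} [TopologicalSpace M] [ChartedSpace (E m) M]
  {N : Type*} [TopologicalSpace N] [ChartedSpace (E k) N]

instance instFiniteDimensionalTangentSpace (x : M) :
    FiniteDimensional ℝ (TangentSpace (𝓡 m) x) :=
  inferInstanceAs (FiniteDimensional ℝ (E m))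

/-- A smooth isometric immersion between Riemannian manifolds (preservation of the metric makes
the differentials injective). -/
structure IsIsometricImmersion
    [IsManifold (𝓡 m) ∞ M] [IsManifold (𝓡 k) ∞ N]
    [RiemannianBundle (fun x : M => TangentSpace (𝓡 m) x)]
    [RiemannianBundle (fun y : N => TangentSpace (𝓡 k) y)] (f : M → N) : Prop where
  contMDiff : ContMDiff (𝓡 m) (𝓡 k) ∞ f
  inner_map : ∀ (x : M) (X Y : TangentSpace (𝓡 m) x),
    ⟪mfderiv (𝓡 m) (𝓡 k) f x X, mfderiv (𝓡 m) (𝓡 k) f x Y⟫_ℝ = ⟪X, Y⟫_ℝ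

/-- The subspace `f_* T_x M` of `ℝᵏ`. -/
def tangentImage (f : M → E k) (x : M) : Submodule ℝ (E k) :=
  LinearMap.range (mvfderiv (𝓡 m) f x : TangentSpace (𝓡 m) x →ₗ[ℝ] E k)

/-- The second fundamental form `α_f(X, Y)` at `x` of an immersion `f : Mᵐ → ℝᵏ`: the component
normal to `f_* T_x M` of the second derivative of `f` in a chart around `x`. -/
def secondFF (f : M → E k) (x : M) :
    TangentSpace (𝓡 m) x →ₗ[ℝ] TangentSpace (𝓡 m) x →ₗ[ℝ] E k :=
  let φ := extChartAt (𝓡 m) x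
  let dφ : TangentSpace (𝓡 m) x →ₗ[ℝ] E m := mvfderiv (𝓡 m) φ x
  let hess : E m →ₗ[ℝ] E m →ₗ[ℝ] E k :=
    (fderiv ℝ (fderiv ℝ (f ∘ φ.symm)) (φ x)).toLinearMap₁₂
  (hess.compl₁₂ dφ dφ).compr₂ ((tangentImage m k f x)ᗮ.starProjection : E k →ₗ[ℝ] E k)

/-- The relative nullity subspace `Δ(x) = {X | α_f(X, Y) = 0 for all Y}`. -/
def relativeNullity (f : M → E k) (x : M) : Submodule ℝ (TangentSpace (𝓡 m) x) :=
  LinearMap.ker (secondFF m k f x)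

variable [IsManifold (𝓡 m) ∞ M] [RiemannianBundle (fun x : M => TangentSpace (𝓡 m) x)]

/-- The shape operator `A_ξ` of `f` at `x`, characterized by
`⟪A_ξ X, Y⟫ = ⟪α_f(X, Y), ξ⟫`. -/
def shapeOperator (f : M → E k) (x : M) (ξ : E k) :
    TangentSpace (𝓡 m) x →ₗ[ℝ] TangentSpace (𝓡 m) x where
  toFun X := LinearMap.adjoint (secondFF m k f x X) ξ
  map_add' X Y := by simp
  map_smul' c X := by simp

/-- The third fundamental form
`III_f(X, Y) = ∑ᵢ ⟪α_f(X, Xᵢ), α_f(Y, Xᵢ)⟫`, `(Xᵢ)` an orthonormal basis of `T_x M`. -/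
def thirdFF (f : M → E k) (x : M) (X Y : TangentSpace (𝓡 m) x) : ℝ :=
  let b := stdOrthonormalBasis ℝ (TangentSpace (𝓡 m) x)
  ∑ i, ⟪secondFF m k f x X (b i), secondFF m k f x Y (b i)⟫_ℝ

/-- The Gauss map `x ↦ f_* T_x M`. A point of the Grassmannian is represented, as usual, by the
orthogonal projection onto the subspace. -/
def gaussMap (f : M → E k) (x : M) : E k →L[ℝ] E k :=
  (tangentImage m k f x).starProjection

/-- The metric induced on `M` by the graph `M → M × Gr_m(ℝᵏ)` of the Gauss map. The standard
symmetric metric of the Grassmannian is, in terms of orthogonal projections,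
`⟨S, T⟩ = (1/2) tr (S T)`. -/
def gaussGraphMetric (f : M → E k) (x : M) (X Y : TangentSpace (𝓡 m) x) : ℝ :=
  ⟪X, Y⟫_ℝ + (1 / 2) * LinearMap.trace ℝ (E k)
    ((mvfderiv (𝓡 m) (gaussMap m k f) x X : E k →L[ℝ] E k) ∘L
      (mvfderiv (𝓡 m) (gaussMap m k f) x Y : E k →L[ℝ] E k) : E k →L[ℝ] E k)

/-- `f` and `g` have isometric Gauss maps: the graphs of the two Gauss maps induce the same
metric on `M`. -/
def HaveIsometricGaussMaps (f g : M → E k) : Prop :=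
  ∀ (x : M) (X Y : TangentSpace (𝓡 m) x), gaussGraphMetric m k f x X Y = gaussGraphMetric m k g x X Y

/-- `f` and `g` have the same third fundamental form. -/
def HaveEqualThirdFF (f g : M → E k) : Prop :=
  ∀ (x : M) (X Y : TangentSpace (𝓡 m) x), thirdFF m k f x X Y = thirdFF m k g x X Y

/-- The endomorphism `X ↦ (A X)_W` of a subspace `W`. -/
def compression {T : Type*} [NormedAddCommGroup T] [InnerProductSpace ℝ T]
    [FiniteDimensional ℝ T] (W : Submodule ℝ T) (A : T →ₗ[ℝ] T) : W →ₗ[ℝ] W :=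
  (W.orthogonalProjectionOnto : T →ₗ[ℝ] W) ∘ₗ A ∘ₗ W.subtype

/-- The component `X_{W^⊥}` of a vector orthogonal to a subspace `W`. -/
def orthComponent {T : Type*} [NormedAddCommGroup T] [InnerProductSpace ℝ T]
    [FiniteDimensional ℝ T] (W : Submodule ℝ T) (X : T) : T :=
  Wᗮ.starProjection X

/-! ### Elliptic Sbrana-Cartan hypersurfaces -/

/-- The Levi-Civita derivative `∇_X Y` at `x` of a vector field `Y`, for the metric induced by an
isometric immersion `f`: `f_* ∇_X Y` is the tangential component of the Euclidean derivative of
`f_* Y` in the direction `X` (the adjoint of `f_*` is the tangential projection followed by the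
inverse of `f_*`). -/
def covDeriv (f : M → E k) (Y : ∀ y : M, TangentSpace (𝓡 m) y) (x : M)
    (X : TangentSpace (𝓡 m) x) : TangentSpace (𝓡 m) x :=
  LinearMap.adjoint (mvfderiv (𝓡 m) f x : TangentSpace (𝓡 m) x →ₗ[ℝ] E k)
    (mvfderiv (𝓡 m) (fun y => mvfderiv (𝓡 m) f y (Y y)) x X)

/-- The vector field `Y` is smooth at `x`. -/
def SmoothFieldAt (Y : ∀ y : M, TangentSpace (𝓡 m) y) (x : M) : Prop :=
  ContMDiffAt (𝓡 m) (𝓡 m).tangent ∞ (fun y => (⟨y, Y y⟩ : TangentBundle (𝓡 m) M)) x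

/-- The component of `∇_X Y` orthogonal to the relative nullity of `f`. -/
def horCovDeriv (f : M → E k) (Y : ∀ y : M, TangentSpace (𝓡 m) y) (x : M)
    (X : TangentSpace (𝓡 m) x) : TangentSpace (𝓡 m) x :=
  orthComponent (relativeNullity m k f x) (covDeriv m k f Y x X)

/-- `J` is a smooth tensor on `Δ^⊥` (extended by zero to `Δ`) with `J² = -I`, parallel along the
relative nullity `Δ` of `f`, and such that every splitting tensor
`C_T X = -(∇_X T)_{Δ^⊥}`, `T ∈ Γ(Δ)`, lies in `span {I, J}`. -/
structure IsEllipticTensor (f : M → E k)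
    (J : ∀ x : M, TangentSpace (𝓡 m) x →ₗ[ℝ] TangentSpace (𝓡 m) x) : Prop where
  map_nullity : ∀ x, ∀ T ∈ relativeNullity m k f x, J x T = 0
  map_mem : ∀ x X, J x X ∈ (relativeNullity m k f x)ᗮ
  sq : ∀ x, ∀ X ∈ (relativeNullity m k f x)ᗮ, J x (J x X) = -X
  smooth : ∀ (x : M) (Y : ∀ y : M, TangentSpace (𝓡 m) y),
    SmoothFieldAt m Y x → SmoothFieldAt m (fun y => J y (Y y)) x
  parallel : ∀ (x : M) (Y : ∀ y : M, TangentSpace (𝓡 m) y), SmoothFieldAt m Y x →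
    (∀ᶠ y in 𝓝 x, Y y ∈ (relativeNullity m k f y)ᗮ) → ∀ T ∈ relativeNullity m k f x,
      horCovDeriv m k f (fun y => J y (Y y)) x T = J x (horCovDeriv m k f Y x T)
  splitting : ∀ (x : M) (T : ∀ y : M, TangentSpace (𝓡 m) y), SmoothFieldAt m T x →
    (∀ᶠ y in 𝓝 x, T y ∈ relativeNullity m k f y) →
      ∃ a b : ℝ, ∀ X ∈ (relativeNullity m k f x)ᗮ, -horCovDeriv m k f T x X = a • X + b • J x X

end Immersions

section Hypersurfaces

variable (m : ℕ) {M : Type*} [TopologicalSpace M] [ChartedSpace (E m) M]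

/-- Near `x`, the hypersurface `F` is a cylinder over a surface `h` in a Euclidean space
`W = ℝ³ ⊆ ℝᵐ⁺¹`. -/
def IsCylinderOverSurfaceAt (F : M → E (m + 1)) (x : M) : Prop :=
  ∃ (W : Submodule ℝ (E (m + 1))) (U : Set M) (D : Set (E 2)) (h : E 2 → E (m + 1))
    (q : M → E 2) (w : M → E (m + 1)),
    Module.finrank ℝ W = 3 ∧ IsOpen U ∧ x ∈ U ∧ IsOpen D ∧
    ContDiffOn ℝ ∞ h D ∧ (∀ u ∈ D, h u ∈ W ∧ Function.Injective (fderiv ℝ h u)) ∧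
    ContMDiffOn (𝓡 m) (𝓡 2) ∞ q U ∧ ContMDiffOn (𝓡 m) (𝓡 (m + 1)) ∞ w U ∧
    ∀ y ∈ U, q y ∈ D ∧ w y ∈ Wᗮ ∧ F y = h (q y) + w y

/-- Near `x`, the hypersurface `F` is a cylinder over the cone, with some vertex `p`, of a surface
`h` in the unit sphere `𝕊³` of a Euclidean space `W = ℝ⁴ ⊆ ℝᵐ⁺¹`. -/
def IsCylinderOverConeAt (F : M → E (m + 1)) (x : M) : Prop :=
  ∃ (W : Submodule ℝ (E (m + 1))) (p : E (m + 1)) (U : Set M) (D : Set (E 2))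
    (h : E 2 → E (m + 1)) (q : M → E 2) (t : M → ℝ) (w : M → E (m + 1)),
    Module.finrank ℝ W = 4 ∧ IsOpen U ∧ x ∈ U ∧ IsOpen D ∧
    ContDiffOn ℝ ∞ h D ∧
    (∀ u ∈ D, h u ∈ W ∧ ‖h u‖ = 1 ∧ Function.Injective (fderiv ℝ h u)) ∧
    ContMDiffOn (𝓡 m) (𝓡 2) ∞ q U ∧ ContMDiffOn (𝓡 m) 𝓘(ℝ, ℝ) ∞ t U ∧
    ContMDiffOn (𝓡 m) (𝓡 (m + 1)) ∞ w U ∧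
    ∀ y ∈ U, q y ∈ D ∧ 0 < t y ∧ w y ∈ Wᗮ ∧ F y = p + t y • h (q y) + w y

/-- Surface-like hypersurfaces. -/
def IsSurfaceLike (F : M → E (m + 1)) : Prop :=
  (∀ x, IsCylinderOverSurfaceAt m F x) ∨ (∀ x, IsCylinderOverConeAt m F x)

variable [IsManifold (𝓡 m) ∞ M] [RiemannianBundle (fun x : M => TangentSpace (𝓡 m) x)]

/-- A Sbrana-Cartan hypersurface: an isometric immersion of rank two everywhere that admits
an isometric immersion of the same Riemannian manifold not congruent to it. -/
structure IsSbranaCartan (F : M → E (m + 1)) : Prop where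
  isometric : IsIsometricImmersion m (m + 1) F
  rank_two : ∀ x, Module.finrank ℝ (relativeNullity m (m + 1) F x) + 2 = m
  deformable : ∃ G : M → E (m + 1), IsIsometricImmersion m (m + 1) G ∧
    ¬ ∃ τ : E (m + 1) ≃ᵢ E (m + 1), ∀ x, G x = τ (F x)

/-- A Sbrana-Cartan hypersurface of elliptic type: it is not surface-like, and the tensor `J` on
`Δ^⊥` associated with it satisfies `J² = -I`. -/
structure IsEllipticSbranaCartan (F : M → E (m + 1)) : Prop extends IsSbranaCartan m F where
  not_surfaceLike : ¬ IsSurfaceLike m F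
  exists_tensor : ∃ J : ∀ x : M, TangentSpace (𝓡 m) x →ₗ[ℝ] TangentSpace (𝓡 m) x,
    IsEllipticTensor m (m + 1) F J

end Hypersurfaces

end GaussMaps

end

/-! Tracing the Gauss equation of `f` gives `Ric(X, Y) = ⟪α_f(X, Y), tr α_f⟫ - III_f(X, Y)`, and the
Ricci tensor depends only on the metric of `M`. Equality of the third fundamental forms thus reduces
to equality of the mean curvature terms. The trace hypothesis says that `tr α_f` has no component
normal to `F`. It is therefore tangent to `F(M̄)`, and its products with second derivatives of `f`
are determined by components along `F_* TM̄`. These are Christoffel symbols of `M̄` plus a term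
coming from `j`, hence the same for `G`.

The argument uses full second derivatives in charts rather than their normal parts. Their tangential
components (`inner_fderiv_fderiv_fderiv_eq`) and their curvature expression (`inner_hessian_sub_eq`)
are determined by the induced metric. The chain rule `exists_hessian_comp_eq` relates those of `F ∘
j` to those of `F`, and `sum_inner_normal_eq` performs the contraction, removing the tangential
parts only at the end.

For the Gauss maps, differentiating the tangent projection `P` shows that `dP` sends tangent vectors
to values of `α_f`. Half of `tr(dP dP)` is then `III_f`, so the graph metric is the metric of `M`
plus `III_f` (`gaussGraphMetric_eq`), and both conclusions are equivalent. -/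

namespace GaussMaps

/-! ### Second derivatives in coordinates and the induced metric. -/

section Flat

variable {V H : Type*} [NormedAddCommGroup V] [NormedSpace ℝ V]
  [NormedAddCommGroup H] [InnerProductSpace ℝ H]

/-- Derivative of the coefficient `⟪Df v, Df w⟫` of the induced metric. -/
theorem hasFDerivAt_inner_fderiv {f : V → H} {p : V} (hf : ContDiffAt ℝ 2 f p) (v w : V) :
    ∃ L : V →L[ℝ] ℝ, HasFDerivAt (fun y => ⟪fderiv ℝ f y v, fderiv ℝ f y w⟫_ℝ) L p ∧
      ∀ u, L u = ⟪fderiv ℝ (fderiv ℝ f) p u v, fderiv ℝ f p w⟫_ℝ +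
        ⟪fderiv ℝ (fderiv ℝ f) p u w, fderiv ℝ f p v⟫_ℝ := by
  have h1 : HasFDerivAt (fderiv ℝ f) (fderiv ℝ (fderiv ℝ f) p) p :=
    ((hf.fderiv_right (m := 1) (by norm_num)).differentiableAt (by norm_num)).hasFDerivAt
  have hv := h1.clm_apply (hasFDerivAt_const v p)
  have hw := h1.clm_apply (hasFDerivAt_const w p)
  refine ⟨_, hv.inner ℝ hw, fun u => ?_⟩
  simp [real_inner_comm, add_comm]

theorem fderiv_fderiv_comm {f : V → H} {p : V} (hf : ContDiffAt ℝ 2 f p) (u v : V) :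
    fderiv ℝ (fderiv ℝ f) p u v = fderiv ℝ (fderiv ℝ f) p v u :=
  (hf.isSymmSndFDerivAt (by simp)).eq u v

/-- The Christoffel symbols of the first kind depend only on the induced metric. -/
theorem inner_fderiv_fderiv_fderiv_eq {f g : V → H} {p : V}
    (hf : ContDiffAt ℝ 2 f p) (hg : ContDiffAt ℝ 2 g p)
    (h : ∀ᶠ y in 𝓝 p, ∀ u v, ⟪fderiv ℝ f y u, fderiv ℝ f y v⟫_ℝ = ⟪fderiv ℝ g y u, fderiv ℝ g y v⟫_ℝ)
    (u v w : V) :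
    ⟪fderiv ℝ (fderiv ℝ f) p u v, fderiv ℝ f p w⟫_ℝ =
      ⟪fderiv ℝ (fderiv ℝ g) p u v, fderiv ℝ g p w⟫_ℝ := by
  have key : ∀ u v w, ⟪fderiv ℝ (fderiv ℝ f) p u v, fderiv ℝ f p w⟫_ℝ +
        ⟪fderiv ℝ (fderiv ℝ f) p u w, fderiv ℝ f p v⟫_ℝ =
      ⟪fderiv ℝ (fderiv ℝ g) p u v, fderiv ℝ g p w⟫_ℝ +
        ⟪fderiv ℝ (fderiv ℝ g) p u w, fderiv ℝ g p v⟫_ℝ := by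
    intro u v w
    obtain ⟨L, hL, eL⟩ := hasFDerivAt_inner_fderiv hf v w
    obtain ⟨L', hL', eL'⟩ := hasFDerivAt_inner_fderiv hg v w
    rw [← eL, ← eL', hL.unique (hL'.congr_of_eventuallyEq (h.mono fun y hy => hy v w))]
  -- Koszul's trick: with symmetric second derivatives, `a + b - c` leaves twice the wanted product.
  have a := key u v w
  have b := key v w u
  have c := key w u v
  rw [fderiv_fderiv_comm hf v u, fderiv_fderiv_comm hg v u] at b
  rw [fderiv_fderiv_comm hf w u, fderiv_fderiv_comm hg w u, fderiv_fderiv_comm hf w v,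
    fderiv_fderiv_comm hg w v] at c
  linarith

/-- Gauss equation in flat coordinates: two maps with the same induced metric have the same
curvature expression in their Hessians. -/
theorem inner_hessian_sub_eq {f g : V → H} {p : V}
    (hf : ContDiffAt ℝ 3 f p) (hg : ContDiffAt ℝ 3 g p)
    (h : ∀ᶠ y in 𝓝 p, ∀ u v, ⟪fderiv ℝ f y u, fderiv ℝ f y v⟫_ℝ = ⟪fderiv ℝ g y u, fderiv ℝ g y v⟫_ℝ)
    (u v w z : V) :
    ⟪fderiv ℝ (fderiv ℝ f) p u v, fderiv ℝ (fderiv ℝ f) p z w⟫_ℝ -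
        ⟪fderiv ℝ (fderiv ℝ f) p z v, fderiv ℝ (fderiv ℝ f) p u w⟫_ℝ =
      ⟪fderiv ℝ (fderiv ℝ g) p u v, fderiv ℝ (fderiv ℝ g) p z w⟫_ℝ -
        ⟪fderiv ℝ (fderiv ℝ g) p z v, fderiv ℝ (fderiv ℝ g) p u w⟫_ℝ := by
  have deriv1 : ∀ {f : V → H}, ContDiffAt ℝ 3 f p → ∀ u v w, ∃ L : V →L[ℝ] ℝ,
      HasFDerivAt (fun y => ⟪fderiv ℝ (fderiv ℝ f) y u v, fderiv ℝ f y w⟫_ℝ) L p ∧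
      ∀ z, L z = ⟪fderiv ℝ (fderiv ℝ (fderiv ℝ f)) p z u v, fderiv ℝ f p w⟫_ℝ +
        ⟪fderiv ℝ (fderiv ℝ f) p u v, fderiv ℝ (fderiv ℝ f) p z w⟫_ℝ := by
    intro f hf u v w
    have c2 : ContDiffAt ℝ 2 (fderiv ℝ f) p := hf.fderiv_right (by norm_num)
    have h1 : HasFDerivAt (fderiv ℝ f) (fderiv ℝ (fderiv ℝ f) p) p :=
      (c2.differentiableAt (by norm_num)).hasFDerivAt
    have h2 : HasFDerivAt (fderiv ℝ (fderiv ℝ f)) (fderiv ℝ (fderiv ℝ (fderiv ℝ f)) p) p :=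
      ((c2.fderiv_right (m := 1) (by norm_num)).differentiableAt (by norm_num)).hasFDerivAt
    have hu := (h2.clm_apply (hasFDerivAt_const u p)).clm_apply (hasFDerivAt_const v p)
    have hw := h1.clm_apply (hasFDerivAt_const w p)
    refine ⟨_, hu.inner ℝ hw, fun z => ?_⟩
    simp [add_comm]
  have symm3 : ∀ {f : V → H}, ContDiffAt ℝ 3 f p → ∀ u v z,
      fderiv ℝ (fderiv ℝ (fderiv ℝ f)) p z u v = fderiv ℝ (fderiv ℝ (fderiv ℝ f)) p u z v := by
    intro f hf u v z
    have c2 : ContDiffAt ℝ 2 (fderiv ℝ f) p := hf.fderiv_right (by norm_num)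
    rw [(c2.isSymmSndFDerivAt (by simp)).eq z u]
  -- The Christoffel symbols agree on a neighbourhood, not only at `p`, so they can be
  -- differentiated.
  have ev : ∀ u v w, (fun y => ⟪fderiv ℝ (fderiv ℝ f) y u v, fderiv ℝ f y w⟫_ℝ) =ᶠ[𝓝 p]
      fun y => ⟪fderiv ℝ (fderiv ℝ g) y u v, fderiv ℝ g y w⟫_ℝ := by
    intro u v w
    filter_upwards [h.eventually_nhds, hf.eventually (by simp), hg.eventually (by simp)]
      with y hy hfy hgy
    exact inner_fderiv_fderiv_fderiv_eq (hfy.of_le (by norm_num)) (hgy.of_le (by norm_num)) hy u v w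
  have key : ∀ u z,
      ⟪fderiv ℝ (fderiv ℝ (fderiv ℝ f)) p z u v, fderiv ℝ f p w⟫_ℝ +
        ⟪fderiv ℝ (fderiv ℝ f) p u v, fderiv ℝ (fderiv ℝ f) p z w⟫_ℝ =
      ⟪fderiv ℝ (fderiv ℝ (fderiv ℝ g)) p z u v, fderiv ℝ g p w⟫_ℝ +
        ⟪fderiv ℝ (fderiv ℝ g) p u v, fderiv ℝ (fderiv ℝ g) p z w⟫_ℝ := by
    intro u z
    obtain ⟨L, hL, eL⟩ := deriv1 hf u v w
    obtain ⟨L', hL', eL'⟩ := deriv1 hg u v w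
    rw [← eL, ← eL', hL.unique (hL'.congr_of_eventuallyEq (ev u v w))]
  -- Third derivatives are symmetric in `u` and `z`, so they cancel in the difference of these two
  -- identities, leaving only products of Hessians.
  have a := key u z
  have b := key z u
  rw [symm3 hf, symm3 hg] at a
  linarith

/-- Second-order chain rule. -/
theorem fderiv_fderiv_comp {U : Type*} [NormedAddCommGroup U] [NormedSpace ℝ U]
    {F : V → H} {j : U → V} {p : U} (hF : ContDiffAt ℝ 2 F (j p)) (hj : ContDiffAt ℝ 2 j p)
    (u v : U) :
    fderiv ℝ (fderiv ℝ (F ∘ j)) p u v =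
      fderiv ℝ (fderiv ℝ F) (j p) (fderiv ℝ j p u) (fderiv ℝ j p v) +
        fderiv ℝ F (j p) (fderiv ℝ (fderiv ℝ j) p u v) := by
  have hj1 : HasFDerivAt j (fderiv ℝ j p) p := (hj.differentiableAt (by norm_num)).hasFDerivAt
  have hF2 : HasFDerivAt (fderiv ℝ F) (fderiv ℝ (fderiv ℝ F) (j p)) (j p) :=
    ((hF.fderiv_right (m := 1) (by norm_num)).differentiableAt (by norm_num)).hasFDerivAt
  have hj2 : HasFDerivAt (fderiv ℝ j) (fderiv ℝ (fderiv ℝ j) p) p :=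
    ((hj.fderiv_right (m := 1) (by norm_num)).differentiableAt (by norm_num)).hasFDerivAt
  have ev : fderiv ℝ (F ∘ j) =ᶠ[𝓝 p] fun y => (fderiv ℝ F (j y)).comp (fderiv ℝ j y) := by
    filter_upwards [hj.continuousAt.eventually (hF.eventually (by simp)), hj.eventually (by simp)]
      with y hFy hjy
    exact fderiv_comp y (hFy.differentiableAt (by norm_num)) (hjy.differentiableAt (by norm_num))
  rw [ev.fderiv_eq, (HasFDerivAt.clm_comp (c := fun y => fderiv ℝ F (j y)) (hF2.comp p hj1) hj2).fderiv]
  simp [add_comm]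

end Flat

/-! ### Contraction of the Gauss equation and a trace formula. -/

section LinearAlgebra

variable {T V H : Type*} [NormedAddCommGroup T] [InnerProductSpace ℝ T]
  [NormedAddCommGroup V] [InnerProductSpace ℝ V]
  [NormedAddCommGroup H] [InnerProductSpace ℝ H]

/-- An isometry carries an orthonormal basis to one of its range. This expresses tangential parts
through pairings with `L (e i)`, the quantities determined by the metric. -/
theorem inner_starProjection_range_eq_sum (L : V →ₗᵢ[ℝ] H) (a b : H)
    [(LinearMap.range L.toLinearMap).HasOrthogonalProjection] {ι : Type*} [Fintype ι]
    (e : OrthonormalBasis ι ℝ V) :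
    ⟪(LinearMap.range L.toLinearMap).starProjection a, b⟫_ℝ =
      ∑ i, ⟪a, L (e i)⟫_ℝ * ⟪b, L (e i)⟫_ℝ := by
  let e' : OrthonormalBasis ι ℝ (LinearMap.range L.toLinearMap) := e.map L.equivRange
  rw [e'.starProjection_eq_sum_rankOne]
  simp only [e', sum_apply, sum_inner, InnerProductSpace.rankOne_apply, inner_smul_left]
  refine Finset.sum_congr rfl fun i _ => ?_
  simp [real_inner_comm]

theorem inner_starProjection_orthogonal (K : Submodule ℝ H) [K.HasOrthogonalProjection] (a b : H) :
    ⟪Kᗮ.starProjection a, Kᗮ.starProjection b⟫_ℝ = ⟪a, b⟫_ℝ - ⟪K.starProjection a, b⟫_ℝ := by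
  rw [Submodule.inner_starProjection_left_eq_right,
    Submodule.starProjection_eq_self_iff.2 (Submodule.starProjection_apply_mem _ _),
    ← Submodule.inner_starProjection_left_eq_right, Submodule.starProjection_orthogonal_val,
    inner_sub_left]

/-- Contracted Gauss equation. Two families of second derivatives `βF`, `βG` with the same tangential
components and the same curvature expression, whose traces are tangent to the hypersurfaces with
tangent spaces the ranges of `LF`, `LG`, have the same third fundamental form. -/
theorem sum_inner_normal_eq [FiniteDimensional ℝ T] [FiniteDimensional ℝ V] [FiniteDimensional ℝ H]
    {ι : Type*} [Fintype ι] (e : OrthonormalBasis ι ℝ T)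
    (LF LG : V →ₗᵢ[ℝ] H) (Lf Lg : T →ₗᵢ[ℝ] H) (βF βG : T → T → H)
    (symmF : ∀ X Y, βF X Y = βF Y X) (symmG : ∀ X Y, βG X Y = βG Y X)
    (hV : ∀ X Y w, ⟪βF X Y, LF w⟫_ℝ = ⟪βG X Y, LG w⟫_ℝ)
    (hT : ∀ X Y Z, ⟪βF X Y, Lf Z⟫_ℝ = ⟪βG X Y, Lg Z⟫_ℝ)
    (gauss : ∀ u v w z, ⟪βF u v, βF z w⟫_ℝ - ⟪βF z v, βF u w⟫_ℝ =
      ⟪βG u v, βG z w⟫_ℝ - ⟪βG z v, βG u w⟫_ℝ)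
    (hF : ∀ ξ ∈ (LinearMap.range LF.toLinearMap)ᗮ, ∑ i, ⟪βF (e i) (e i), ξ⟫_ℝ = 0)
    (hG : ∀ ξ ∈ (LinearMap.range LG.toLinearMap)ᗮ, ∑ i, ⟪βG (e i) (e i), ξ⟫_ℝ = 0)
    (X Y : T) :
    ∑ i, ⟪(LinearMap.range Lf.toLinearMap)ᗮ.starProjection (βF X (e i)),
        (LinearMap.range Lf.toLinearMap)ᗮ.starProjection (βF Y (e i))⟫_ℝ =
      ∑ i, ⟪(LinearMap.range Lg.toLinearMap)ᗮ.starProjection (βG X (e i)),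
        (LinearMap.range Lg.toLinearMap)ᗮ.starProjection (βG Y (e i))⟫_ℝ := by
  -- The summed vector `∑ β(eᵢ, eᵢ)` lies in the range of `L`, so its product with any `a` only
  -- involves components of `a` along `L`.
  have mean : ∀ (L : V →ₗᵢ[ℝ] H) (β : T → T → H),
      (∀ ξ ∈ (LinearMap.range L.toLinearMap)ᗮ, ∑ i, ⟪β (e i) (e i), ξ⟫_ℝ = 0) → ∀ a,
      ∑ i, ⟪a, β (e i) (e i)⟫_ℝ = ∑ i, ∑ k, ⟪a, L (stdOrthonormalBasis ℝ V k)⟫_ℝ *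
          ⟪β (e i) (e i), L (stdOrthonormalBasis ℝ V k)⟫_ℝ := by
    intro L β h a
    have h0 := h _ (Submodule.starProjection_apply_mem _ a)
    simp only [Submodule.starProjection_orthogonal_val, inner_sub_right, Finset.sum_sub_distrib,
      sub_eq_zero] at h0
    simp only [← inner_starProjection_range_eq_sum L _ _ (stdOrthonormalBasis ℝ V)]
    rw [Finset.sum_congr rfl fun i _ => real_inner_comm (β (e i) (e i)) a, h0]
    exact Finset.sum_congr rfl fun i _ => real_inner_comm _ _
  have hmean : ∑ i, ⟪βF X Y, βF (e i) (e i)⟫_ℝ = ∑ i, ⟪βG X Y, βG (e i) (e i)⟫_ℝ := by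
    rw [mean LF βF hF, mean LG βG hG]
    simp only [hV]
  have hg : ∑ i, ⟪βF X (e i), βF Y (e i)⟫_ℝ = ∑ i, ⟪βG X (e i), βG Y (e i)⟫_ℝ := by
    -- Setting `z = w = eᵢ` and summing is the Ricci contraction; the mean curvature terms drop out
    -- by `hmean`.
    have := Finset.sum_congr (rfl : Finset.univ = Finset.univ) fun i _ => gauss X Y (e i) (e i)
    simp only [Finset.sum_sub_distrib, hmean, sub_right_inj] at this
    simpa only [symmF _ Y, symmG _ Y, real_inner_comm] using this
  -- A product of normal parts is the full product minus the tangential one; the latter is intrinsic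
  -- by `hT`.
  simp only [inner_starProjection_orthogonal, Finset.sum_sub_distrib, hg]
  simp only [inner_starProjection_range_eq_sum _ _ _ e, hT]

/-- The trace of a product of two symmetric operators, the first of which exchanges `K` and `Kᗮ`. -/
theorem trace_comp_eq_two_mul_sum_inner [FiniteDimensional ℝ H] (K : Submodule ℝ H)
    {ι : Type*} [Fintype ι] (b : OrthonormalBasis ι ℝ K) (A B : H →L[ℝ] H)
    (hA : ∀ a c, ⟪A a, c⟫_ℝ = ⟪a, A c⟫_ℝ) (hB : ∀ a c, ⟪B a, c⟫_ℝ = ⟪a, B c⟫_ℝ)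
    (hAK : ∀ a, A a = A (K.starProjection a) + K.starProjection (A a)) :
    LinearMap.trace ℝ H (A ∘L B : H →L[ℝ] H) = 2 * ∑ i, ⟪A (b i), B (b i)⟫_ℝ := by
  have hP : ∀ a, K.starProjection a = ∑ i, ⟪(b i : H), a⟫_ℝ • (b i : H) := fun a => by
    rw [b.starProjection_eq_sum_rankOne]
    simp
  let h := stdOrthonormalBasis ℝ H
  rw [LinearMap.trace_eq_sum_inner _ h]
  have : ∀ k, ⟪h k, (A ∘L B) (h k)⟫_ℝ =
      ∑ i, (⟪B (b i), h k⟫_ℝ * ⟪h k, A (b i)⟫_ℝ + ⟪B (A (b i)), h k⟫_ℝ * ⟪h k, b i⟫_ℝ) := by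
    intro k
    -- The splitting `A = A P + P A` is applied at `B (h k)`. Each summand contributes the same
    -- amount by Parseval, whence the factor 2.
    rw [ContinuousLinearMap.comp_apply, hAK, hP, hP]
    simp only [map_sum, map_smul, inner_add_right, inner_sum, inner_smul_right,
      Finset.sum_add_distrib, hB, hA]
  simp only [ContinuousLinearMap.coe_coe, this]
  rw [Finset.sum_comm]
  simp only [Finset.sum_add_distrib, OrthonormalBasis.sum_inner_mul_inner]
  rw [two_mul]
  congr 1 <;> refine Finset.sum_congr rfl fun i _ => ?_
  · exact real_inner_comm _ _
  · exact hB _ _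

end LinearAlgebra

/-! ### The tangent projection and its derivative. -/

section Projection

variable {V H : Type*} [NormedAddCommGroup V] [InnerProductSpace ℝ V] [FiniteDimensional ℝ V]
  [NormedAddCommGroup H] [InnerProductSpace ℝ H] [FiniteDimensional ℝ H]

/-- The normal equations of least squares, `P = L (L*L)⁻¹ L*`. In this form the differentiable
dependence of `P` on `L` is visible. -/
theorem starProjection_range_eq (L : V →L[ℝ] H) (hL : IsUnit (L.adjoint ∘L L)) :
    (LinearMap.range (L : V →ₗ[ℝ] H)).starProjection =
      L ∘L (Ring.inverse (L.adjoint ∘L L) ∘L L.adjoint) := by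
  ext1 a
  refine Submodule.eq_starProjection_of_mem_orthogonal ⟨_, rfl⟩ ?_
  rintro _ ⟨w, rfl⟩
  have h := congrArg (fun S : V →L[ℝ] V => S (L.adjoint a)) (Ring.mul_inverse_cancel _ hL)
  simp only [mul_apply_eq_comp, ContinuousLinearMap.comp_apply,
    one_apply_eq_self] at h
  have := congrArg (fun z => ⟪w, z⟫_ℝ) h
  simp only [ContinuousLinearMap.adjoint_inner_right] at this
  simp [inner_sub_right, this]

/-- `L*L a = 0` forces `‖L a‖² = 0`, and in finite dimension injective endomorphisms are bijective.
-/
theorem isUnit_adjoint_comp (L : V →L[ℝ] H) (hL : Function.Injective L) :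
    IsUnit (L.adjoint ∘L L) := by
  rw [ContinuousLinearMap.isUnit_iff_bijective]
  have : Function.Injective (L.adjoint ∘L L) := by
    rw [injective_iff_map_eq_zero]
    intro a ha
    apply (injective_iff_map_eq_zero L).1 hL
    rw [← inner_self_eq_zero (𝕜 := ℝ), ← ContinuousLinearMap.adjoint_inner_right]
    rw [ContinuousLinearMap.comp_apply] at ha
    rw [ha, inner_zero_right]
  exact ⟨this, LinearMap.injective_iff_surjective (f := ((L.adjoint ∘L L : V →L[ℝ] V) : V →ₗ[ℝ] V)).1 this⟩

/-- The orthogonal projection onto the tangent spaces of an immersion is differentiable. -/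
theorem differentiableAt_starProjection_range {f : V → H} {p : V} (hf : ContDiffAt ℝ 2 f p)
    (hi : Function.Injective (fderiv ℝ f p)) :
    DifferentiableAt ℝ
      (fun y => (LinearMap.range (fderiv ℝ f y : V →ₗ[ℝ] H)).starProjection) p := by
  have h1 : DifferentiableAt ℝ (fderiv ℝ f) p :=
    (hf.fderiv_right (m := 1) (by norm_num)).differentiableAt (by norm_num)
  have hadj : DifferentiableAt ℝ (fun y => ContinuousLinearMap.adjoint (fderiv ℝ f y)) p :=
    ((ContinuousLinearMap.adjoint (𝕜 := ℝ) (E := V)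
      (F := H)).toContinuousLinearEquiv.toContinuousLinearMap.differentiableAt).comp p h1
  have hS := hadj.clm_comp h1
  have hu := isUnit_adjoint_comp _ hi
  -- Invertibility is an open condition, so the formula for the projection holds near `p` and not
  -- just at `p`.
  have ev : ∀ᶠ y in 𝓝 p, IsUnit ((fderiv ℝ f y).adjoint ∘L fderiv ℝ f y) :=
    hS.continuousAt.eventually (Units.isOpen.mem_nhds hu)
  have hinv : DifferentiableAt ℝ
      (fun y => Ring.inverse ((fderiv ℝ f y).adjoint ∘L fderiv ℝ f y)) p :=
    DifferentiableAt.comp (g := Ring.inverse) p (differentiableAt_inverse hu) hS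
  exact (h1.clm_comp (hinv.clm_comp hadj)).congr_of_eventuallyEq
    (ev.mono fun y hy => starProjection_range_eq _ hy)

/-- The half trace metric of the derivative of the tangent projection, in terms of the normal
components of the Hessian. -/
theorem trace_fderiv_starProjection_range {T : Type*} [NormedAddCommGroup T]
    [InnerProductSpace ℝ T] {f : V → H} {p : V} (hf : ContDiffAt ℝ 2 f p)
    (hi : Function.Injective (fderiv ℝ f p)) {ι : Type*} [Fintype ι]
    (e : OrthonormalBasis ι ℝ T) (L : T →ₗᵢ[ℝ] H) (d : T ≃ₗ[ℝ] V)
    (hL : ∀ X, L X = fderiv ℝ f p (d X)) (u v : V) :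
    let K := LinearMap.range (fderiv ℝ f p : V →ₗ[ℝ] H)
    let P := fun y => (LinearMap.range (fderiv ℝ f y : V →ₗ[ℝ] H)).starProjection
    LinearMap.trace ℝ H ((fderiv ℝ P p u) ∘L (fderiv ℝ P p v) : H →L[ℝ] H) =
      2 * ∑ i, ⟪Kᗮ.starProjection (fderiv ℝ (fderiv ℝ f) p u (d (e i))),
        Kᗮ.starProjection (fderiv ℝ (fderiv ℝ f) p v (d (e i)))⟫_ℝ := by
  intro K P
  have hP : HasFDerivAt P (fderiv ℝ P p) p :=
    (differentiableAt_starProjection_range hf hi).hasFDerivAt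
  have h1 : HasFDerivAt (fderiv ℝ f) (fderiv ℝ (fderiv ℝ f) p) p :=
    ((hf.fderiv_right (m := 1) (by norm_num)).differentiableAt (by norm_num)).hasFDerivAt
  -- The frame `e` is orthonormal in `T`, whereas its coordinates `d (e i)` need not be orthonormal
  -- in `V`; `d` will be the differential of a chart.
  have hK : LinearMap.range L.toLinearMap = K := by
    ext a
    constructor
    · rintro ⟨X, rfl⟩
      exact ⟨d X, (hL X).symm⟩
    · rintro ⟨w, rfl⟩
      exact ⟨d.symm w, by simp [hL]⟩
  have symm : ∀ u a c, ⟪fderiv ℝ P p u a, c⟫_ℝ = ⟪a, fderiv ℝ P p u c⟫_ℝ := by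
    intro u a c
    have ha := (hP.clm_apply (hasFDerivAt_const a p)).inner ℝ (hasFDerivAt_const c p)
    have hc := (hasFDerivAt_const a p).inner ℝ (hP.clm_apply (hasFDerivAt_const c p))
    have he : (fun y => ⟪P y a, c⟫_ℝ) = fun y => ⟪a, P y c⟫_ℝ :=
      funext fun y => Submodule.inner_starProjection_left_eq_right _ a c
    rw [he] at ha
    simpa using congrArg (fun S : V →L[ℝ] ℝ => S u) (ha.unique hc)
  -- Derivative of `P² = P`.
  have idem : ∀ u a, fderiv ℝ P p u a =
      fderiv ℝ P p u (K.starProjection a) + K.starProjection (fderiv ℝ P p u a) := by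
    intro u a
    have ha := hP.clm_apply (hasFDerivAt_const a p)
    have hc := hP.clm_apply (hP.clm_apply (hasFDerivAt_const a p))
    have he : (fun y => P y (P y a)) = fun y => P y a :=
      funext fun y => Submodule.starProjection_eq_self_iff.2 (Submodule.starProjection_apply_mem _ _)
    rw [he] at hc
    simpa [add_comm] using! congrArg (fun S : V →L[ℝ] H => S u) (ha.unique hc)
  -- Derivative of `P (f_* w) = f_* w`: on tangent vectors `dP` is the second fundamental form.
  have tang : ∀ u w, fderiv ℝ P p u (fderiv ℝ f p w) =
      Kᗮ.starProjection (fderiv ℝ (fderiv ℝ f) p u w) := by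
    intro u w
    have ha := h1.clm_apply (hasFDerivAt_const w p)
    have hc := hP.clm_apply ha
    have he : (fun y => P y (fderiv ℝ f y w)) = fun y => fderiv ℝ f y w :=
      funext fun y => Submodule.starProjection_eq_self_iff.2 ⟨w, rfl⟩
    rw [he] at hc
    have := congrArg (fun S : V →L[ℝ] H => S u) (ha.unique hc)
    rw [Submodule.starProjection_orthogonal_val, eq_sub_iff_add_eq]
    simpa [add_comm] using! this.symm
  let b : OrthonormalBasis ι ℝ (LinearMap.range L.toLinearMap) := e.map L.equivRange
  rw [trace_comp_eq_two_mul_sum_inner _ b _ _ (symm u) (symm v) (by rw [hK]; exact idem u)]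
  have hb : ∀ i, (b i : H) = fderiv ℝ f p (d (e i)) := fun i => by simp [b, hL]
  simp only [hb, tang]

end Projection

/-! ### Chart expressions of differentials and tangent spaces. -/

theorem secondFF_apply {m k : ℕ} {M : Type*} [TopologicalSpace M]
    [ChartedSpace (E m) M] (f : M → E k) (x : M) (X Y : TangentSpace (𝓡 m) x) :
    secondFF m k f x X Y = (tangentImage m k f x)ᗮ.starProjection
      (fderiv ℝ (fderiv ℝ (f ∘ (extChartAt (𝓡 m) x).symm)) (extChartAt (𝓡 m) x x)
        (mvfderiv (𝓡 m) (extChartAt (𝓡 m) x) x X) (mvfderiv (𝓡 m) (extChartAt (𝓡 m) x) x Y)) :=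
  rfl

theorem eventuallyEq_comp_symm_comp {m : ℕ} {M F : Type*} [TopologicalSpace M]
    [ChartedSpace (E m) M] {x y : M} (hy : y ∈ (extChartAt (𝓡 m) x).source) (f : M → F) :
    f =ᶠ[𝓝 y] (f ∘ (extChartAt (𝓡 m) x).symm) ∘ extChartAt (𝓡 m) x := by
  filter_upwards [(isOpen_extChartAt_source x).mem_nhds hy] with z hz
  simp only [Function.comp_apply, (extChartAt (𝓡 m) x).left_inv hz]

section Charts

variable {m k : ℕ} {M : Type*} [TopologicalSpace M] [ChartedSpace (E m) M]
  [IsManifold (𝓡 m) ∞ M]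
  {F : Type*} [NormedAddCommGroup F] [NormedSpace ℝ F]

theorem isManifold_one_of_smooth (m : ℕ) (M : Type*) [TopologicalSpace M] [ChartedSpace (E m) M]
    [IsManifold (𝓡 m) ∞ M] : IsManifold (𝓡 m) 1 M :=
  IsManifold.of_le (n := ∞) (by norm_num)

/-- Chain rule through a chart centred at `x`, taken at any point `y` of its domain. Leaving `g'`
free lets it apply to the Gauss map and to the coordinate expression of `j`. -/
theorem mvfderiv_eq_of_eventuallyEq {x y : M} (hy : y ∈ (extChartAt (𝓡 m) x).source)
    {g : M → F} {g' : E m → F} (hg' : DifferentiableAt ℝ g' (extChartAt (𝓡 m) x y))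
    (h : g =ᶠ[𝓝 y] g' ∘ extChartAt (𝓡 m) x) :
    mvfderiv (𝓡 m) g y =
      (fderiv ℝ g' (extChartAt (𝓡 m) x y)) ∘L (mvfderiv (𝓡 m) (extChartAt (𝓡 m) x) y) := by
  have := isManifold_one_of_smooth m M
  have hφ : MDifferentiableAt (𝓡 m) 𝓘(ℝ, E m) (extChartAt (𝓡 m) x) y :=
    mdifferentiableAt_extChartAt (by simpa using hy)
  have h2 : HasMFDerivAt (𝓡 m) 𝓘(ℝ, F) g y _ :=
    (hg'.hasFDerivAt.hasMFDerivAt.comp y hφ.hasMFDerivAt).congr_of_eventuallyEq h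
  ext v
  simp only [mvfderiv, h2.mfderiv]
  rfl

/-- The differential of a chart at a point of its domain. -/
noncomputable def chartEquiv (x y : M) (hy : y ∈ (extChartAt (𝓡 m) x).source) :
    TangentSpace (𝓡 m) y ≃ₗ[ℝ] E m :=
  LinearEquiv.ofBijective (mvfderiv (𝓡 m) (extChartAt (𝓡 m) x) y : TangentSpace (𝓡 m) y →ₗ[ℝ] E m) <| by
    have := isManifold_one_of_smooth m M
    obtain ⟨e, he⟩ := isInvertible_mfderiv_extChartAt hy
    have : ∀ v, mvfderiv (𝓡 m) (extChartAt (𝓡 m) x) y v = e v := fun v => by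
      rw [← ContinuousLinearEquiv.coe_coe, he]; rfl
    constructor
    · intro v w hvw
      exact e.injective ((this v).symm.trans (Eq.trans hvw (this w)))
    · intro v
      obtain ⟨w, hw⟩ := e.surjective v
      exact ⟨w, (this w).trans hw⟩

@[simp] theorem chartEquiv_apply (x y : M) (hy : y ∈ (extChartAt (𝓡 m) x).source)
    (v : TangentSpace (𝓡 m) y) :
    chartEquiv x y hy v = mvfderiv (𝓡 m) (extChartAt (𝓡 m) x) y v := rfl

theorem contDiffAt_comp_extChartAt_symm {f : M → F} (hf : ContMDiff (𝓡 m) 𝓘(ℝ, F) ∞ f) {x y : M}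
    (hy : y ∈ (extChartAt (𝓡 m) x).source) :
    ContDiffAt ℝ ∞ (f ∘ (extChartAt (𝓡 m) x).symm) (extChartAt (𝓡 m) x y) := by
  have h1 : ContMDiffAt 𝓘(ℝ, E m) (𝓡 m) ∞ (extChartAt (𝓡 m) x).symm (extChartAt (𝓡 m) x y) :=
    (contMDiffOn_extChartAt_symm x).contMDiffAt
      ((isOpen_extChartAt_target x).mem_nhds ((extChartAt (𝓡 m) x).map_source hy))
  exact (hf.contMDiffAt.comp _ h1).contDiffAt

theorem mvfderiv_eq_fderiv_comp {f : M → F} (hf : ContMDiff (𝓡 m) 𝓘(ℝ, F) ∞ f) {x y : M}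
    (hy : y ∈ (extChartAt (𝓡 m) x).source) (v : TangentSpace (𝓡 m) y) :
    mvfderiv (𝓡 m) f y v =
      fderiv ℝ (f ∘ (extChartAt (𝓡 m) x).symm) (extChartAt (𝓡 m) x y)
        (mvfderiv (𝓡 m) (extChartAt (𝓡 m) x) y v) := by
  rw [mvfderiv_eq_of_eventuallyEq hy
    ((contDiffAt_comp_extChartAt_symm hf hy).differentiableAt (by simp))
    (eventuallyEq_comp_symm_comp hy f)]
  rfl

/-- The chart differential is onto, so factoring through it does not change the range. The point `y`
may differ from the centre because the Gauss map is differentiated in a fixed chart. -/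
theorem tangentImage_eq_range_fderiv {f : M → E k} (hf : ContMDiff (𝓡 m) (𝓡 k) ∞ f) {x y : M}
    (hy : y ∈ (extChartAt (𝓡 m) x).source) :
    tangentImage m k f y = LinearMap.range
      (fderiv ℝ (f ∘ (extChartAt (𝓡 m) x).symm) (extChartAt (𝓡 m) x y) : E m →ₗ[ℝ] E k) := by
  ext a
  constructor
  · rintro ⟨X, rfl⟩
    exact ⟨_, (mvfderiv_eq_fderiv_comp hf hy X).symm⟩
  · rintro ⟨w, rfl⟩
    refine ⟨(chartEquiv x y hy).symm w, ?_⟩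
    refine (mvfderiv_eq_fderiv_comp hf hy _).trans ?_
    rw [← chartEquiv_apply x y hy, LinearEquiv.apply_symm_apply]
    rfl

/-! ### Isometric immersions in a chart and the graph metric. -/

section Riemannian

variable [RiemannianBundle (fun x : M => TangentSpace (𝓡 m) x)]

theorem IsIsometricImmersion.inner_mvfderiv {f : M → E k} (hf : IsIsometricImmersion m k f) (x : M)
    (X Y : TangentSpace (𝓡 m) x) :
    ⟪mvfderiv (𝓡 m) f x X, mvfderiv (𝓡 m) f x Y⟫_ℝ = ⟪X, Y⟫_ℝ :=
  hf.inner_map x X Y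

/-- The differential of an isometric immersion into Euclidean space, as a linear isometry. -/
noncomputable def IsIsometricImmersion.differential {f : M → E k} (hf : IsIsometricImmersion m k f)
    (x : M) : TangentSpace (𝓡 m) x →ₗᵢ[ℝ] E k :=
  LinearMap.isometryOfInner (mvfderiv (𝓡 m) f x : TangentSpace (𝓡 m) x →ₗ[ℝ] E k)
    (hf.inner_mvfderiv x)

@[simp] theorem IsIsometricImmersion.differential_apply {f : M → E k}
    (hf : IsIsometricImmersion m k f) (x : M) (X : TangentSpace (𝓡 m) x) :
    hf.differential x X = mvfderiv (𝓡 m) f x X := rfl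

/-- Two isometric immersions of the same manifold induce the same metric in coordinates. -/
theorem IsIsometricImmersion.eventually_inner_fderiv_eq {f g : M → E k}
    (hf : IsIsometricImmersion m k f) (hg : IsIsometricImmersion m k g) (x : M) :
    ∀ᶠ p in 𝓝 (extChartAt (𝓡 m) x x), ∀ u v,
      ⟪fderiv ℝ (f ∘ (extChartAt (𝓡 m) x).symm) p u,
        fderiv ℝ (f ∘ (extChartAt (𝓡 m) x).symm) p v⟫_ℝ =
      ⟪fderiv ℝ (g ∘ (extChartAt (𝓡 m) x).symm) p u,
        fderiv ℝ (g ∘ (extChartAt (𝓡 m) x).symm) p v⟫_ℝ := by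
  filter_upwards [extChartAt_target_mem_nhds (I := 𝓡 m) x] with p hp u v
  have hy := (extChartAt (𝓡 m) x).map_target hp
  -- Every coordinate vector comes from a tangent vector, on which both immersions realise the
  -- metric of `M`.
  obtain ⟨X, rfl⟩ := (chartEquiv x _ hy).surjective u
  obtain ⟨Y, rfl⟩ := (chartEquiv x _ hy).surjective v
  have hp' := (extChartAt (𝓡 m) x).right_inv hp
  have h1 := mvfderiv_eq_fderiv_comp hf.contMDiff hy
  have h2 := mvfderiv_eq_fderiv_comp hg.contMDiff hy
  rw [hp'] at h1 h2
  simp only [chartEquiv_apply]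
  rw [← h1, ← h1, ← h2, ← h2, hf.inner_mvfderiv, hg.inner_mvfderiv]

theorem IsIsometricImmersion.injective_fderiv {f : M → E k}
    (hf : IsIsometricImmersion m k f) (x : M) :
    Function.Injective (fderiv ℝ (f ∘ (extChartAt (𝓡 m) x).symm) (extChartAt (𝓡 m) x x)) := by
  intro u v huv
  obtain ⟨X, rfl⟩ := (chartEquiv x x (mem_extChartAt_source x)).surjective u
  obtain ⟨Y, rfl⟩ := (chartEquiv x x (mem_extChartAt_source x)).surjective v
  simp only [chartEquiv_apply, ← mvfderiv_eq_fderiv_comp hf.contMDiff (mem_extChartAt_source x)]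
    at huv
  rw [(hf.differential x).injective huv]

/-- The metric induced by the graph of the Gauss map is the sum of the given metric and the third
fundamental form. -/
theorem IsIsometricImmersion.gaussGraphMetric_eq {f : M → E k}
    (hf : IsIsometricImmersion m k f) (x : M) (X Y : TangentSpace (𝓡 m) x) :
    gaussGraphMetric m k f x X Y = ⟪X, Y⟫_ℝ + thirdFF m k f x X Y := by
  have hx := mem_extChartAt_source (I := 𝓡 m) x
  have hf2 : ContDiffAt ℝ 2 (f ∘ (extChartAt (𝓡 m) x).symm) (extChartAt (𝓡 m) x x) :=
    (contDiffAt_comp_extChartAt_symm hf.contMDiff hx).of_le (by norm_cast)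
  have hev : gaussMap m k f =ᶠ[𝓝 x] (fun p => (LinearMap.range
      (fderiv ℝ (f ∘ (extChartAt (𝓡 m) x).symm) p : E m →ₗ[ℝ] E k)).starProjection) ∘
        extChartAt (𝓡 m) x := by
    filter_upwards [extChartAt_source_mem_nhds (I := 𝓡 m) x] with y hy
    simp only [gaussMap, Function.comp_apply, tangentImage_eq_range_fderiv hf.contMDiff hy]
  have h := mvfderiv_eq_of_eventuallyEq hx
    (differentiableAt_starProjection_range hf2 (hf.injective_fderiv x)) hev
  have ht := trace_fderiv_starProjection_range hf2 (hf.injective_fderiv x)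
    (stdOrthonormalBasis ℝ (TangentSpace (𝓡 m) x)) (hf.differential x) (chartEquiv x x hx)
    (fun Z => mvfderiv_eq_fderiv_comp hf.contMDiff hx Z)
    (mvfderiv (𝓡 m) (extChartAt (𝓡 m) x) x X) (mvfderiv (𝓡 m) (extChartAt (𝓡 m) x) x Y)
  simp only [gaussGraphMetric, thirdFF, h, secondFF_apply, ContinuousLinearMap.comp_apply,
    tangentImage_eq_range_fderiv hf.contMDiff hx]
  rw [ht]
  simp

end Riemannian

end Charts

/-! ### Restriction to a submanifold and equality of third fundamental forms. -/

section Composition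

variable {n m k : ℕ} {N : Type*} [TopologicalSpace N] [ChartedSpace (E m) N]
  [IsManifold (𝓡 m) ∞ N] [RiemannianBundle (fun y : N => TangentSpace (𝓡 m) y)]
  {M : Type*} [TopologicalSpace M] [ChartedSpace (E n) M]
  [IsManifold (𝓡 n) ∞ M] [RiemannianBundle (fun x : M => TangentSpace (𝓡 n) x)]
  {F G : N → E k} {j : M → N}

theorem IsIsometricImmersion.mvfderiv_comp (hF : IsIsometricImmersion m k F)
    (hj : IsIsometricImmersion n m j) (x : M) (X : TangentSpace (𝓡 n) x) :
    mvfderiv (𝓡 n) (F ∘ j) x X = mvfderiv (𝓡 m) F (j x) (mfderiv (𝓡 n) (𝓡 m) j x X) := by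
  have h := mfderiv_comp x (hF.contMDiff.mdifferentiableAt (by simp))
    (hj.contMDiff.mdifferentiableAt (by simp) : MDifferentiableAt (𝓡 n) (𝓡 m) j x)
  simp only [mvfderiv, h]
  rfl

theorem IsIsometricImmersion.comp (hF : IsIsometricImmersion m k F)
    (hj : IsIsometricImmersion n m j) : IsIsometricImmersion n k (F ∘ j) where
  contMDiff := hF.contMDiff.comp hj.contMDiff
  inner_map x X Y := by
    have := hF.inner_mvfderiv (j x) (mfderiv (𝓡 n) (𝓡 m) j x X) (mfderiv (𝓡 n) (𝓡 m) j x Y)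
    rw [← hF.mvfderiv_comp hj, ← hF.mvfderiv_comp hj, hj.inner_map] at this
    exact this

/-- The second derivative of `F ∘ j` in coordinates: the second derivative of `F` on the tangent
vectors of `j`, plus a term tangent to `F` which does not depend on `F`. -/
theorem IsIsometricImmersion.exists_hessian_comp_eq (hj : IsIsometricImmersion n m j) (x : M) :
    ∃ γ : TangentSpace (𝓡 n) x → TangentSpace (𝓡 n) x → E m,
      ∀ F : N → E k, ContMDiff (𝓡 m) (𝓡 k) ∞ F → ∀ X Y : TangentSpace (𝓡 n) x,
      fderiv ℝ (fderiv ℝ ((F ∘ j) ∘ (extChartAt (𝓡 n) x).symm)) (extChartAt (𝓡 n) x x)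
        (mvfderiv (𝓡 n) (extChartAt (𝓡 n) x) x X) (mvfderiv (𝓡 n) (extChartAt (𝓡 n) x) x Y) =
      fderiv ℝ (fderiv ℝ (F ∘ (extChartAt (𝓡 m) (j x)).symm)) (extChartAt (𝓡 m) (j x) (j x))
        (mvfderiv (𝓡 m) (extChartAt (𝓡 m) (j x)) (j x) (mfderiv (𝓡 n) (𝓡 m) j x X))
        (mvfderiv (𝓡 m) (extChartAt (𝓡 m) (j x)) (j x) (mfderiv (𝓡 n) (𝓡 m) j x Y)) +
      fderiv ℝ (F ∘ (extChartAt (𝓡 m) (j x)).symm) (extChartAt (𝓡 m) (j x) (j x)) (γ X Y) := by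
  have hx := mem_extChartAt_source (I := 𝓡 n) x
  have hjx := mem_extChartAt_source (I := 𝓡 m) (j x)
  have := isManifold_one_of_smooth m N
  set ψ := extChartAt (𝓡 n) x with hψ
  set φ := extChartAt (𝓡 m) (j x) with hφ
  let c : E n → E m := φ ∘ j ∘ ψ.symm
  have hcont : ContinuousAt j x := hj.contMDiff.continuous.continuousAt
  have hp : c (ψ x) = φ (j x) := by simp only [c, Function.comp_apply, ψ.left_inv hx]
  have hc : ContDiffAt ℝ ∞ c (ψ x) := by
    have := (contMDiffAt_iff.1 (hj.contMDiff.contMDiffAt (x := x))).2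
    simpa only [modelWithCornersSelf_coe, Set.range_id, contDiffWithinAt_univ] using this
  have hc2 : ContDiffAt ℝ 2 c (ψ x) := hc.of_le (by norm_cast)
  have hsrc : ∀ᶠ y in 𝓝 x, j y ∈ φ.source :=
    hcont.eventually (extChartAt_source_mem_nhds (I := 𝓡 m) (j x))
  have hdc : ∀ X, fderiv ℝ c (ψ x) (mvfderiv (𝓡 n) ψ x X) =
      mvfderiv (𝓡 m) φ (j x) (mfderiv (𝓡 n) (𝓡 m) j x X) := by
    intro X
    have h1 := mvfderiv_eq_of_eventuallyEq (g := φ ∘ j) hx (hc.differentiableAt (by simp)) (by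
      filter_upwards [extChartAt_source_mem_nhds (I := 𝓡 n) x] with y hy
      simp only [c, Function.comp_apply, ← hψ, ψ.left_inv hy])
    have h2 := mfderiv_comp x
      (mdifferentiableAt_extChartAt (I := 𝓡 m) (x := j x) (y := j x) (by simp))
      (hj.contMDiff.mdifferentiableAt (by simp) : MDifferentiableAt (𝓡 n) (𝓡 m) j x)
    have h3 := congrArg (fun S => S X) h1
    refine h3.symm.trans ?_
    simp only [mvfderiv] at h2 ⊢
    rw [h2]
    rfl
  -- The witness is the Hessian of `j` in coordinates. Being chosen before `F`, it serves for `F`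
  -- and `G` alike.
  refine ⟨fun X Y => fderiv ℝ (fderiv ℝ c) (ψ x) (mvfderiv (𝓡 n) ψ x X) (mvfderiv (𝓡 n) ψ x Y),
    fun F hF X Y => ?_⟩
  have hF2 : ContDiffAt ℝ 2 (F ∘ φ.symm) (φ (j x)) :=
    (contDiffAt_comp_extChartAt_symm hF hjx).of_le (by norm_cast)
  have hcomp : (F ∘ j) ∘ ψ.symm =ᶠ[𝓝 (ψ x)] (F ∘ φ.symm) ∘ c := by
    have hs : Tendsto ψ.symm (𝓝 (ψ x)) (𝓝 x) := by
      have := continuousAt_extChartAt_symm (I := 𝓡 n) x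
      rw [ContinuousAt, ← hψ, ψ.left_inv hx] at this
      exact this
    filter_upwards [hs.eventually hsrc] with p hp
    simp only [c, Function.comp_apply, φ.left_inv hp]
  rw [hcomp.fderiv.fderiv_eq, fderiv_fderiv_comp (hp ▸ hF2) hc2, hdc, hdc, hp]

/-- If the trace of the compressions to `j_* TM` of the shape operators of `F` vanishes, then the
trace of the second derivative of `F ∘ j` is tangent to `F`. -/
theorem IsIsometricImmersion.sum_inner_hessian_comp_eq_zero (hF : IsIsometricImmersion m k F)
    (hj : IsIsometricImmersion n m j) (x : M)
    (htr : ∀ ξ : E k, ξ ∈ (tangentImage m k F (j x))ᗮ → ‖ξ‖ = 1 →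
        LinearMap.trace ℝ _ (compression
          (LinearMap.range (mfderiv (𝓡 n) (𝓡 m) j x).toLinearMap)
          (shapeOperator m k F (j x) ξ)) = 0)
    {ι : Type*} [Fintype ι] (e : OrthonormalBasis ι ℝ (TangentSpace (𝓡 n) x))
    (ξ : E k) (hξ : ξ ∈ (tangentImage m k F (j x))ᗮ) :
    ∑ i, ⟪fderiv ℝ (fderiv ℝ ((F ∘ j) ∘ (extChartAt (𝓡 n) x).symm)) (extChartAt (𝓡 n) x x)
        (mvfderiv (𝓡 n) (extChartAt (𝓡 n) x) x (e i))
        (mvfderiv (𝓡 n) (extChartAt (𝓡 n) x) x (e i)), ξ⟫_ℝ = 0 := by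
  have hjx := mem_extChartAt_source (I := 𝓡 m) (j x)
  obtain ⟨γ, hγ⟩ := hj.exists_hessian_comp_eq (k := k) x
  let L : TangentSpace (𝓡 n) x →ₗᵢ[ℝ] TangentSpace (𝓡 m) (j x) :=
    LinearMap.isometryOfInner (mfderiv (𝓡 n) (𝓡 m) j x).toLinearMap (hj.inner_map x)
  let b : OrthonormalBasis ι ℝ (LinearMap.range (mfderiv (𝓡 n) (𝓡 m) j x).toLinearMap) :=
    e.map L.equivRange
  have hb : ∀ i, (b i : TangentSpace (𝓡 m) (j x)) = mfderiv (𝓡 n) (𝓡 m) j x (e i) := fun i => rfl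
  have hzero : ∀ ξ ∈ (tangentImage m k F (j x))ᗮ, ∑ i, ⟪secondFF m k F (j x)
      (mfderiv (𝓡 n) (𝓡 m) j x (e i)) (mfderiv (𝓡 n) (𝓡 m) j x (e i)), ξ⟫_ℝ = 0 := by
    intro ξ hξ
    rcases eq_or_ne ξ 0 with rfl | h0
    · simp
    -- The trace condition is given for unit normals only; normalising extends it to every `ξ` by
    -- linearity.
    have h1 := htr (‖ξ‖⁻¹ • ξ) (Submodule.smul_mem _ _ hξ) (norm_smul_inv_norm h0)
    rw [LinearMap.trace_eq_sum_inner _ b] at h1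
    have h2 : ∀ i, ⟪b i, compression
        (LinearMap.range (mfderiv (𝓡 n) (𝓡 m) j x).toLinearMap)
          (shapeOperator m k F (j x) (‖ξ‖⁻¹ • ξ)) (b i)⟫_ℝ =
        ‖ξ‖⁻¹ * ⟪secondFF m k F (j x)
      (mfderiv (𝓡 n) (𝓡 m) j x (e i)) (mfderiv (𝓡 n) (𝓡 m) j x (e i)), ξ⟫_ℝ := by
      intro i
      simp only [compression, LinearMap.comp_apply, ContinuousLinearMap.coe_coe,
        Submodule.subtype_apply, Submodule.inner_orthogonalProjectionOnto_eq_of_mem_left]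
      simp only [shapeOperator, LinearMap.coe_mk, AddHom.coe_mk, LinearMap.adjoint_inner_right, hb,
        inner_smul_right]
    rw [Finset.sum_congr rfl fun i _ => h2 i, ← Finset.mul_sum] at h1
    exact (mul_eq_zero.1 h1).resolve_left (inv_ne_zero (norm_ne_zero_iff.2 h0))
  rw [← hzero ξ hξ]
  refine Finset.sum_congr rfl fun i _ => ?_
  rw [hγ F hF.contMDiff, inner_add_left, secondFF_apply,
    Submodule.inner_starProjection_left_eq_right, Submodule.starProjection_eq_self_iff.2 hξ]
  -- The remaining term, the image of `γ` under the differential of `F`, is tangent to `F` and so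
  -- orthogonal to `ξ`.
  rw [tangentImage_eq_range_fderiv hF.contMDiff hjx] at hξ
  exact add_eq_left.2 ((Submodule.mem_orthogonal _ _).1 hξ _ ⟨_, rfl⟩)

/-- Two isometric immersions of `N` restrict to immersions of `M` with the same third fundamental
form as soon as the compressions to `j_* TM` of their shape operators are trace free. -/
theorem thirdFF_comp_eq (hF : IsIsometricImmersion m k F) (hG : IsIsometricImmersion m k G)
    (hj : IsIsometricImmersion n m j) (x : M)
    (htrF : ∀ ξ : E k, ξ ∈ (tangentImage m k F (j x))ᗮ → ‖ξ‖ = 1 →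
        LinearMap.trace ℝ _ (compression
          (LinearMap.range (mfderiv (𝓡 n) (𝓡 m) j x).toLinearMap)
          (shapeOperator m k F (j x) ξ)) = 0)
    (htrG : ∀ ξ : E k, ξ ∈ (tangentImage m k G (j x))ᗮ → ‖ξ‖ = 1 →
        LinearMap.trace ℝ _ (compression
          (LinearMap.range (mfderiv (𝓡 n) (𝓡 m) j x).toLinearMap)
          (shapeOperator m k G (j x) ξ)) = 0)
    (X Y : TangentSpace (𝓡 n) x) :
    thirdFF n k (F ∘ j) x X Y = thirdFF n k (G ∘ j) x X Y := by
  have hx := mem_extChartAt_source (I := 𝓡 n) x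
  have hjx := mem_extChartAt_source (I := 𝓡 m) (j x)
  have hf := hF.comp hj
  have hg := hG.comp hj
  have cF := contDiffAt_comp_extChartAt_symm hF.contMDiff hjx
  have cG := contDiffAt_comp_extChartAt_symm hG.contMDiff hjx
  have cf := contDiffAt_comp_extChartAt_symm hf.contMDiff hx
  have cg := contDiffAt_comp_extChartAt_symm hg.contMDiff hx
  have h2 : (2 : WithTop ℕ∞) ≤ ∞ := by norm_cast
  have h3 : (3 : WithTop ℕ∞) ≤ ∞ := by norm_cast
  have evV := hF.eventually_inner_fderiv_eq hG (j x)
  have evT := hf.eventually_inner_fderiv_eq hg x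
  obtain ⟨γ, hγ⟩ := hj.exists_hessian_comp_eq (k := k) x
  simp only [thirdFF, secondFF_apply]
  refine sum_inner_normal_eq (stdOrthonormalBasis ℝ (TangentSpace (𝓡 n) x))
    (hF.differential (j x)) (hG.differential (j x)) (hf.differential x) (hg.differential x)
    (fun X Y => fderiv ℝ (fderiv ℝ ((F ∘ j) ∘ (extChartAt (𝓡 n) x).symm)) (extChartAt (𝓡 n) x x)
        (mvfderiv (𝓡 n) (extChartAt (𝓡 n) x) x X) (mvfderiv (𝓡 n) (extChartAt (𝓡 n) x) x Y))
    (fun X Y => fderiv ℝ (fderiv ℝ ((G ∘ j) ∘ (extChartAt (𝓡 n) x).symm)) (extChartAt (𝓡 n) x x)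
        (mvfderiv (𝓡 n) (extChartAt (𝓡 n) x) x X) (mvfderiv (𝓡 n) (extChartAt (𝓡 n) x) x Y))
    (fun X Y => fderiv_fderiv_comm (cf.of_le h2) _ _)
    (fun X Y => fderiv_fderiv_comm (cg.of_le h2) _ _) ?_ ?_
    (fun u v w z => inner_hessian_sub_eq (cf.of_le h3) (cg.of_le h3) evT _ _ _ _)
    (hF.sum_inner_hessian_comp_eq_zero hj x htrF _)
    (hG.sum_inner_hessian_comp_eq_zero hj x htrG _) X Y
  -- Along `F_* w` the Hessian of `F ∘ j` gives a Christoffel symbol of `M̄` plus the metric product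
  -- of `γ X Y` with the coordinates of `w`; neither changes when `F` is replaced by `G`.
  · intro X Y w
    rw [hγ F hF.contMDiff, hγ G hG.contMDiff, hF.differential_apply, hG.differential_apply,
      mvfderiv_eq_fderiv_comp hF.contMDiff hjx, mvfderiv_eq_fderiv_comp hG.contMDiff hjx,
      inner_add_left, inner_add_left,
      inner_fderiv_fderiv_fderiv_eq (cF.of_le h2) (cG.of_le h2) evV, evV.self_of_nhds]
  · intro X Y Z
    rw [hf.differential_apply, hg.differential_apply,
      mvfderiv_eq_fderiv_comp hf.contMDiff hx, mvfderiv_eq_fderiv_comp hg.contMDiff hx,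
      inner_fderiv_fderiv_fderiv_eq (cf.of_le h2) (cg.of_le h2) evT]

end Composition

end GaussMaps

/-! ### The proposition. -/

theorem mainTheorem2 (n : ℕ) (hn : 3 ≤ n)
    -- the Riemannian manifold `M̄ⁿ⁺¹`
    (Mbar : Type*) [TopologicalSpace Mbar] [ChartedSpace (GaussMaps.E (n + 1)) Mbar]
    [IsManifold (𝓡 (n + 1)) ∞ Mbar]
    [RiemannianBundle (fun y : Mbar => TangentSpace (𝓡 (n + 1)) y)]
    [IsContMDiffRiemannianBundle (𝓡 (n + 1)) ∞ (GaussMaps.E (n + 1))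
      (fun y : Mbar => TangentSpace (𝓡 (n + 1)) y)]
    -- the Riemannian manifold `Mⁿ`
    (M : Type*) [TopologicalSpace M] [ChartedSpace (GaussMaps.E n) M]
    [IsManifold (𝓡 n) ∞ M]
    [RiemannianBundle (fun x : M => TangentSpace (𝓡 n) x)]
    [IsContMDiffRiemannianBundle (𝓡 n) ∞ (GaussMaps.E n)
      (fun x : M => TangentSpace (𝓡 n) x)]
    (F G : Mbar → GaussMaps.E (n + 2))
    (hF : GaussMaps.IsEllipticSbranaCartan (n + 1) F)
    (hG : GaussMaps.IsIsometricImmersion (n + 1) (n + 2) G)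
    (j : M → Mbar) (hj : GaussMaps.IsIsometricImmersion n (n + 1) j)
    (htrF : ∀ (x : M) (ξ : GaussMaps.E (n + 2)),
      ξ ∈ (GaussMaps.tangentImage (n + 1) (n + 2) F (j x))ᗮ → ‖ξ‖ = 1 →
        LinearMap.trace ℝ _ (GaussMaps.compression
          (LinearMap.range (mfderiv (𝓡 n) (𝓡 (n + 1)) j x).toLinearMap)
          (GaussMaps.shapeOperator (n + 1) (n + 2) F (j x) ξ)) = 0)
    (htrG : ∀ (x : M) (ξ : GaussMaps.E (n + 2)),
      ξ ∈ (GaussMaps.tangentImage (n + 1) (n + 2) G (j x))ᗮ → ‖ξ‖ = 1 →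
        LinearMap.trace ℝ _ (GaussMaps.compression
          (LinearMap.range (mfderiv (𝓡 n) (𝓡 (n + 1)) j x).toLinearMap)
          (GaussMaps.shapeOperator (n + 1) (n + 2) G (j x) ξ)) = 0) :
    GaussMaps.HaveIsometricGaussMaps n (n + 2) (F ∘ j) (G ∘ j) ∧
      GaussMaps.HaveEqualThirdFF n (n + 2) (F ∘ j) (G ∘ j) := by
  have hF' : GaussMaps.IsIsometricImmersion (n + 1) (n + 2) F := hF.isometric
  have hIII : GaussMaps.HaveEqualThirdFF n (n + 2) (F ∘ j) (G ∘ j) := fun x X Y =>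
    GaussMaps.thirdFF_comp_eq hF' hG hj x (htrF x) (htrG x) X Y
  refine ⟨fun x X Y => ?_, hIII⟩
  rw [(hF'.comp hj).gaussGraphMetric_eq, (hG.comp hj).gaussGraphMetric_eq, hIII x X Y]
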